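/- Let $\overline{\mathbb Q}$ be an algebraic closure of $\mathbb Q$. For $\alpha\in\overline{\mathbb Q}$ let $H(\alpha)\ge 1$ be its absolute multiplicative Weil height, that is, $$H(\alpha)=\prod_v \max\{1,\|\alpha\|_v\}^{[K_v:\mathbb Q_v]/[K:\mathbb Q]}$$ for any number field $K$ containing $\alpha$, the product being over all places $v$ of $K$, where $\|\cdot\|_v$ extends the usual absolute value on $\mathbb Q_v$, the completion of $\mathbb Q$ at the place below $v$; let $M(\alpha)=H(\alpha)^{[\mathbb Q(\alpha):\mathbb Q]}$ be its Mahler measure. For $\alpha\neq 0$ define the ultrametric Mahler measure $$M_\infty(\alpha)=\inf\Big\{\max_{1\le n\le N}M(\alpha_n)\;:\;N\ge 1,\ \alpha_1,\dots,\alpha_N\in\overline{\mathbb Q}^\times,\ \alpha=\alpha_1\cdots\alpha_N\Big\}.$$ Let $K_\alpha$ be the Galois closure of $\mathbb Q(\alpha)$ over $\mathbb Q$ in $\overline{\mathbb Q}$, and for a number field $K\subseteq\overline{\mathbb Q}$ let $\mathrm{rad}(K)=\{x\in\overline{\mathbb Q}^\times : x^r\in K \text{ for some integer } r\ge 1\}$.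 Theorem. If $\alpha$ is a non-zero algebraic number, then there exist $N\ge 1$ and $\alpha_1,\dots,\alpha_N\in\mathrm{rad}(K_\alpha)$ such that $\alpha=\alpha_1\cdots\alpha_N$ and $M_\infty(\alpha)=\max\{M(\alpha_1),\dots,M(\alpha_N)\}$. In particular, the infimum defining $M_\infty(\alpha)$ is attained. -/

import Mathlib

open scoped IntermediateField

namespace AlgNumber

/-- The Mahler measure `M(x) = H(x) ^ [ℚ(x) : ℚ]` of an algebraic number `x`, where `H` is the
absolute multiplicative Weil height. -/
noncomputable def mahlerMeasure {L : Type*} [Field L] [CharZero L] (x : L) : ℝ :=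
  NumberField.absMulHeight₁ x ^ Module.finrank ℚ ℚ⟮x⟯

/-- The maximum `max {M(a 0), …, M(a N)}` over a non-empty tuple. -/
noncomputable def maxMahler {L : Type*} [Field L] [CharZero L] {N : ℕ} (a : Fin (N + 1) → L) : ℝ :=
  Finset.univ.sup' Finset.univ_nonempty fun n => mahlerMeasure (a n)

/-- The ultrametric Mahler measure: the infimum of `max M(a n)` over all representations
of `α` as a product of a non-empty tuple of non-zero algebraic numbers. (For `α ≠ 0` the set is
non-empty, and it is bounded below, so `sInf` is the genuine infimum.) -/
noncomputable def ultrametricMahler {L : Type*} [Field L] [CharZero L] (α : L) : ℝ :=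
  sInf {m : ℝ | ∃ (N : ℕ) (a : Fin (N + 1) → L),
    (∀ n, a n ≠ 0) ∧ α = ∏ n, a n ∧ m = maxMahler a}

/-- `rad(K)`: the non-zero algebraic numbers having some positive power in `K`. -/
def rad {L : Type*} [Field L] [CharZero L] (K : IntermediateField ℚ L) : Set L :=
  {x | x ≠ 0 ∧ ∃ r : ℕ, 0 < r ∧ x ^ r ∈ K}

/-- The Galois closure `K_α` of `ℚ(α)` over `ℚ`, inside `L`. -/
noncomputable def galoisClosure {L : Type*} [Field L] [CharZero L] (α : L) :
    IntermediateField ℚ L :=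
  IntermediateField.normalClosure ℚ ℚ⟮α⟯ L

end AlgNumber

namespace AlgNumber

open NumberField Height Module

/-! ### Behaviour of heights under extension of number fields -/

section Extension

variable {E F : Type*} [Field E] [Field F] [NumberField E] [NumberField F] [Algebra E F]

/-! Let K be the Galois closure and α = ∏ aᵢ any factorization. Let Pᵢ be the product of the dᵢ
conjugates of aᵢ over K, and choose bᵢ with bᵢ ^ dᵢ = Pᵢ. Conjugates have equal height, so H(bᵢ) ≤
H(aᵢ); as K is normal, Pᵢ lies in K ∩ ℚ(aᵢ), over which aᵢ still has degree dᵢ, so deg bᵢ ≤ deg aᵢ.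
Hence M(bᵢ) ≤ M(aᵢ) (`exists_mem_rad_pow_eq`). Taking norms down to K shows that α and ∏ bᵢ differ
by a root of unity, which has measure 1 (`exists_pow_prod_eq`). So factorizations in rad K suffice.

On rad K the values of M below a bound are finite in number, by Northcott applied to the elements P
of K (`finite_mahlerMeasure_rad_le`), so the infimum is a minimum. -/

theorem prod_infinitePlace_pow_mult_eq_prod_embeddings {g : InfinitePlace E → ℝ} :
    ∏ v : InfinitePlace E, g v ^ v.mult = ∏ φ : E →+* ℂ, g (.mk φ) := by
  classical
  rw [← Finset.prod_fiberwise' Finset.univ InfinitePlace.mk g]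
  simp [InfinitePlace.card_filter_mk_eq]

theorem prod_embeddings_comp_algebraMap (f : (E →+* ℂ) → ℝ) :
    ∏ ψ : F →+* ℂ, f (ψ.comp (algebraMap E F)) = (∏ φ : E →+* ℂ, f φ) ^ finrank E F := by
  classical
  rw [← Finset.prod_fiberwise' Finset.univ (fun ψ : F →+* ℂ ↦ ψ.comp (algebraMap E F)) f,
    ← Finset.prod_pow]
  refine Finset.prod_congr rfl fun φ _ ↦ ?_
  rw [Finset.prod_const]
  congr 1
  let : Algebra E ℂ := φ.toAlgebra
  rw [← AlgHom.card E F ℂ, ← Fintype.card_subtype]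
  exact Fintype.card_congr
    { toFun := fun ψ ↦ { ψ.1 with commutes' := fun r ↦ DFunLike.congr_fun ψ.2 r }
      invFun := fun ψ ↦ ⟨ψ.toRingHom, RingHom.ext fun r ↦ ψ.commutes r⟩
      left_inv := fun _ ↦ rfl
      right_inv := fun _ ↦ rfl }

theorem prod_infinitePlace_iSup_algebraMap {ι : Type*} (x : ι → E) :
    ∏ w : InfinitePlace F, (⨆ i, w (algebraMap E F (x i))) ^ w.mult =
      (∏ v : InfinitePlace E, (⨆ i, v (x i)) ^ v.mult) ^ finrank E F := by
  rw [prod_infinitePlace_pow_mult_eq_prod_embeddings,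
    prod_infinitePlace_pow_mult_eq_prod_embeddings, ← prod_embeddings_comp_algebraMap]
  simp

/-- For an integral tuple the finite part of the height is the inverse norm of the ideal it
generates, and extending an ideal to `F` raises its norm to the power [F : E]. -/
theorem finprod_finitePlace_iSup_algebraMap {ι : Type*} [Finite ι] {x : ι → 𝓞 E} (hx : x ≠ 0) :
    ∏ᶠ w : FinitePlace F, ⨆ i, w (algebraMap E F (x i)) =
      (∏ᶠ v : FinitePlace E, ⨆ i, v (x i : E)) ^ finrank E F := by
  have hx' : (fun i ↦ algebraMap (𝓞 E) (𝓞 F) (x i)) ≠ 0 := by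
    obtain ⟨i, hi⟩ := Function.ne_iff.mp hx
    exact Function.ne_iff.mpr ⟨i, by simpa using! hi⟩
  have h₁ := absNorm_mul_finprod_finitePlace_eq_one hx
  have h₂ := absNorm_mul_finprod_finitePlace_eq_one hx'
  have h₃ : Ideal.span (Set.range fun i ↦ algebraMap (𝓞 E) (𝓞 F) (x i)) =
      (Ideal.span (Set.range x)).map (algebraMap (𝓞 E) (𝓞 F)) := by
    rw [Ideal.map_span, ← Set.range_comp]; rfl
  rw [h₃, Ideal.absNorm_algebraMap, Nat.cast_pow, ← IsFractionRing.finrank_eq (𝓞 E) E (𝓞 F) F] at h₂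
  have h₄ : ((Ideal.span (Set.range x)).absNorm : ℝ) ≠ 0 := left_ne_zero_of_mul_eq_one h₁
  refine mul_left_cancel₀ (pow_ne_zero (finrank E F) h₄) ?_
  rw [← mul_pow, h₁, one_pow]
  exact h₂

theorem mulHeight₁_algebraMap (x : E) :
    mulHeight₁ (algebraMap E F x) = mulHeight₁ x ^ finrank E F := by
  obtain ⟨n, hn, -, hx⟩ := exists_nat_le_mulHeight₁ x
  have hn' : (n : E) ≠ 0 := mod_cast hn
  obtain ⟨a, ha⟩ : ∃ a : 𝓞 E, n * x = a := ⟨⟨_, hx⟩, rfl⟩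
  -- Integral projective coordinates for `x = a / n`, so that the ideal norm formula applies.
  let y : Fin 2 → 𝓞 E := ![a, n]
  have hy : y ≠ 0 := Function.ne_iff.mpr ⟨1, by simpa [y] using hn⟩
  have hyE : (fun i ↦ (y i : E)) ≠ 0 := by
    obtain ⟨i, hi⟩ := Function.ne_iff.mp hy
    exact Function.ne_iff.mpr ⟨i, by simpa using! hi⟩
  have hyF : (fun i ↦ algebraMap E F (y i)) ≠ 0 := by
    obtain ⟨i, hi⟩ := Function.ne_iff.mp hyE
    exact Function.ne_iff.mpr ⟨i, by simpa using! hi⟩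
  have h₁ : mulHeight₁ x = mulHeight (fun i ↦ (y i : E)) := by
    rw [← mul_div_cancel_left₀ x hn', mulHeight₁_div_eq_mulHeight]
    congr 1; ext i; fin_cases i <;> simp [y, ha]
  have h₂ : mulHeight₁ (algebraMap E F x) = mulHeight (fun i ↦ algebraMap E F (y i)) := by
    rw [← mul_div_cancel_left₀ x hn', map_div₀, mulHeight₁_div_eq_mulHeight]
    congr 1; ext i; fin_cases i <;> simp [y, ← ha]
  rw [h₁, h₂, NumberField.mulHeight_eq hyE, NumberField.mulHeight_eq hyF, mul_pow,
    prod_infinitePlace_iSup_algebraMap (F := F) (fun i ↦ (y i : E)),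
    finprod_finitePlace_iSup_algebraMap hy]

end Extension

/-! ### The absolute height on algebraic numbers -/

section AbsHeight

variable {L : Type*} [Field L] [CharZero L]

theorem numberField_adjoin {x : L} (hx : IsIntegral ℚ x) : NumberField ℚ⟮x⟯ :=
  have := IntermediateField.adjoin.finiteDimensional hx
  {}

theorem mahlerMeasure_eq_mulHeight₁ (x : L) [NumberField ℚ⟮x⟯] (hx : IsIntegral ℚ x) :
    mahlerMeasure x = mulHeight₁ (IntermediateField.AdjoinSimple.gen ℚ x) := by
  have h0 : finrank ℚ ℚ⟮x⟯ ≠ 0 := finrank_pos.ne'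
  rw [mahlerMeasure, absMulHeight₁, dif_pos hx, Real.rpow_inv_natCast_pow (by positivity) h0]

theorem absMulHeight₁_pow_finrank {F : Type*} [Field F] [NumberField F] (f : F →+* L) (x : F) :
    absMulHeight₁ (f x) ^ finrank ℚ F = mulHeight₁ x := by
  let f' : F →ₐ[ℚ] L := f.toRatAlgHom
  have hx : IsIntegral ℚ (f x) := (IsIntegral.of_finite ℚ x).map f'
  have := numberField_adjoin hx
  have hle : ℚ⟮f x⟯ ≤ f'.fieldRange := by
    rw [IntermediateField.adjoin_simple_le_iff]; exact ⟨x, rfl⟩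
  let e := AlgEquiv.ofInjectiveField f'
  -- Makes `F` an extension of ℚ(f x) in which the generator becomes `x`.
  let g : ℚ⟮f x⟯ →ₐ[ℚ] F :=
    (e.symm : f'.range →ₐ[ℚ] F).comp (ℚ⟮f x⟯.val.codRestrict f'.range fun z ↦ hle z.2)
  have hg : g (IntermediateField.AdjoinSimple.gen ℚ (f x)) = x :=
    e.injective ((e.apply_symm_apply _).trans (Subtype.ext rfl))
  let := g.toRingHom.toAlgebra
  have h : mulHeight₁ x = mahlerMeasure (f x) ^ finrank ℚ⟮f x⟯ F := by
    rw [mahlerMeasure_eq_mulHeight₁ _ hx, ← mulHeight₁_algebraMap, RingHom.algebraMap_toAlgebra]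
    exact congrArg mulHeight₁ hg.symm
  rw [h, mahlerMeasure, ← pow_mul, finrank_mul_finrank]

theorem absMulHeight₁_nonneg (x : L) : 0 ≤ absMulHeight₁ x := by
  unfold absMulHeight₁
  split_ifs <;> positivity

theorem one_le_absMulHeight₁ (x : L) : 1 ≤ absMulHeight₁ x := by
  unfold absMulHeight₁
  split_ifs with hx
  · have := numberField_adjoin hx
    exact Real.one_le_rpow (one_le_mulHeight₁ _) (by positivity)
  · rfl

theorem one_le_mahlerMeasure (x : L) : 1 ≤ mahlerMeasure x :=
  one_le_pow₀ (one_le_absMulHeight₁ x)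

theorem absMulHeight₁_one : absMulHeight₁ (1 : L) = 1 := by
  have h := absMulHeight₁_pow_finrank (algebraMap ℚ L) 1
  simpa using h

theorem finite_setOf_absMulHeight₁_le (K : IntermediateField ℚ L) [FiniteDimensional ℚ K] (B : ℝ) :
    {x : L | x ∈ K ∧ absMulHeight₁ x ≤ B}.Finite := by
  have : NumberField K := {}
  refine ((finite_setOfPred_mulHeight₁_le K (B ^ finrank ℚ K)).image (algebraMap K L)).subset ?_
  rintro x ⟨hx, hB⟩
  refine ⟨⟨x, hx⟩, ?_, rfl⟩
  change mulHeight₁ _ ≤ _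
  rw [← absMulHeight₁_pow_finrank (algebraMap K L)]
  exact pow_le_pow_left₀ (absMulHeight₁_nonneg _) hB _

variable [Algebra.IsAlgebraic ℚ L]

theorem numberField_adjoin_finite (s : Set L) (hs : s.Finite) :
    NumberField (IntermediateField.adjoin ℚ s) :=
  have := hs.to_subtype
  have : FiniteDimensional ℚ (IntermediateField.adjoin ℚ s) :=
    IntermediateField.finiteDimensional_adjoin fun x _ ↦ Algebra.IsIntegral.isIntegral x
  {}

theorem absMulHeight₁_pow (x : L) (n : ℕ) : absMulHeight₁ (x ^ n) = absMulHeight₁ x ^ n := by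
  have := numberField_adjoin (Algebra.IsIntegral.isIntegral (R := ℚ) x)
  let y := IntermediateField.AdjoinSimple.gen ℚ x
  have h₁ := absMulHeight₁_pow_finrank (algebraMap ℚ⟮x⟯ L) (y ^ n)
  rw [mulHeight₁_pow, ← absMulHeight₁_pow_finrank (algebraMap ℚ⟮x⟯ L), pow_right_comm] at h₁
  exact (pow_left_inj₀ (absMulHeight₁_nonneg _) (pow_nonneg (absMulHeight₁_nonneg _) _)
    (finrank_pos (R := ℚ) (M := ℚ⟮x⟯)).ne').mp h₁

theorem absMulHeight₁_mul_le (x y : L) :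
    absMulHeight₁ (x * y) ≤ absMulHeight₁ x * absMulHeight₁ y := by
  have := numberField_adjoin_finite {x, y} (by simp)
  let K := IntermediateField.adjoin ℚ {x, y}
  let x' : K := ⟨x, IntermediateField.subset_adjoin _ _ (by simp)⟩
  let y' : K := ⟨y, IntermediateField.subset_adjoin _ _ (by simp)⟩
  have h (z : K) := absMulHeight₁_pow_finrank (algebraMap K L) z
  rw [← pow_le_pow_iff_left₀ (absMulHeight₁_nonneg _)
    (mul_nonneg (absMulHeight₁_nonneg _) (absMulHeight₁_nonneg _))
    (finrank_pos (R := ℚ) (M := K)).ne', mul_pow]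
  calc _ = mulHeight₁ (x' * y') := h (x' * y')
    _ ≤ mulHeight₁ x' * mulHeight₁ y' := mulHeight₁_mul_le _ _
    _ = _ := by rw [← h, ← h]; rfl

theorem absMulHeight₁_multiset_prod_le (s : Multiset L) :
    absMulHeight₁ s.prod ≤ (s.map absMulHeight₁).prod := by
  induction s using Multiset.induction with
  | empty => simp [absMulHeight₁_one]
  | cons a s ih =>
    rw [Multiset.prod_cons, Multiset.map_cons, Multiset.prod_cons]
    exact (absMulHeight₁_mul_le _ _).trans
      (mul_le_mul_of_nonneg_left ih (absMulHeight₁_nonneg _))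

theorem absMulHeight₁_eq_one_of_pow_eq_one {x : L} {n : ℕ} (hn : n ≠ 0) (hx : x ^ n = 1) :
    absMulHeight₁ x = 1 := by
  have h := absMulHeight₁_pow x n
  rw [hx, absMulHeight₁_one] at h
  exact (pow_eq_one_iff_of_nonneg (absMulHeight₁_nonneg _) hn).mp h.symm

theorem mahlerMeasure_eq_one_of_pow_eq_one {x : L} {n : ℕ} (hn : n ≠ 0) (hx : x ^ n = 1) :
    mahlerMeasure x = 1 := by
  rw [mahlerMeasure, absMulHeight₁_eq_one_of_pow_eq_one hn hx, one_pow]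

theorem absMulHeight₁_algEquiv (σ : L ≃ₐ[ℚ] L) (x : L) :
    absMulHeight₁ (σ x) = absMulHeight₁ x := by
  have := numberField_adjoin (Algebra.IsIntegral.isIntegral (R := ℚ) x)
  let y := IntermediateField.AdjoinSimple.gen ℚ x
  have h₁ := absMulHeight₁_pow_finrank (algebraMap ℚ⟮x⟯ L) y
  have h₂ := absMulHeight₁_pow_finrank ((σ : L →+* L).comp (algebraMap ℚ⟮x⟯ L)) y
  exact (pow_left_inj₀ (absMulHeight₁_nonneg _) (absMulHeight₁_nonneg _)
    (finrank_pos (R := ℚ) (M := ℚ⟮x⟯)).ne').mp (h₂.trans h₁.symm)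

end AbsHeight

open Polynomial

variable {L : Type*} [Field L] [CharZero L]

theorem finiteDimensional_of_le {E F : IntermediateField ℚ L} [FiniteDimensional ℚ F]
    (h : E ≤ F) : FiniteDimensional ℚ E :=
  Module.Finite.of_injective (IntermediateField.inclusion h).toLinearMap
    (IntermediateField.inclusion_injective h)

/-! ### Replacing factors by radicals over a normal field -/

section Normal

variable [IsAlgClosure ℚ L]

instance (priority := low) isAlgebraic_of_isAlgClosure : Algebra.IsAlgebraic ℚ L :=
  IsAlgClosure.isAlgebraic

instance (priority := low) isAlgClosed_of_isAlgClosure : IsAlgClosed L :=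
  IsAlgClosure.isAlgClosed ℚ

theorem isIntegral_intermediateField (K : IntermediateField ℚ L) (x : L) : IsIntegral K x :=
  (Algebra.IsIntegral.isIntegral (R := ℚ) x).tower_top

variable (K : IntermediateField ℚ L)

/-- Galois descent: an automorphism fixing `x` preserves the normal field `K`, hence carries the
minimal polynomial of `x` over `K` to itself. -/
theorem coeff_minpoly_mem_adjoin [Normal ℚ K] (x : L) (i : ℕ) : ((minpoly K x).coeff i : L) ∈ ℚ⟮x⟯ := by
  have : Normal ℚ L := IsAlgClosure.normal ℚ L
  have : IsGalois ℚ L := {}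
  rw [← InfiniteGalois.fixedField_fixingSubgroup ℚ⟮x⟯, IntermediateField.mem_fixedField_iff]
  intro σ hσ
  have hσx : σ x = x := by
    rw [IntermediateField.mem_fixingSubgroup_iff] at hσ
    exact hσ x (IntermediateField.mem_adjoin_simple_self ℚ x)
  let τ : K ≃ₐ[ℚ] K := σ.restrictNormal K
  have hτ (y : K) : (τ y : L) = σ y := σ.restrictNormal_commutes K y
  have hcomp : (algebraMap K L).comp (τ : K →+* K) = (σ : L →+* L).comp (algebraMap K L) :=
    RingHom.ext hτ
  have hroot : aeval x ((minpoly K x).map (τ : K →+* K)) = 0 := by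
    rw [aeval_def, eval₂_map, hcomp]
    have := hom_eval₂ (minpoly K x) (algebraMap K L) (σ : L →+* L) x
    rw [← aeval_def, minpoly.aeval, map_zero, RingHom.coe_coe, hσx] at this
    exact this.symm
  have hx := isIntegral_intermediateField K x
  have hirr : Irreducible ((minpoly K x).map (τ : K →+* K)) :=
    (MulEquiv.irreducible_iff (mapEquiv (τ : K ≃+* K))).mpr (minpoly.irreducible hx)
  have heq := minpoly.eq_of_irreducible_of_monic hirr hroot ((minpoly.monic hx).map _)
  rw [← hτ]
  exact congrArg Subtype.val ((coeff_map (τ : K →+* K) i).symm.trans (congrArg (coeff · i) heq))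

theorem natDegree_minpoly_inf [Normal ℚ K] (x : L) :
    (minpoly ↥(K ⊓ ℚ⟮x⟯) x).natDegree = (minpoly K x).natDegree := by
  set E := K ⊓ ℚ⟮x⟯
  let f : E →+* K := (IntermediateField.inclusion inf_le_left : E →ₐ[ℚ] K)
  have hf : (algebraMap K L).comp f = algebraMap E L := rfl
  have hxK := isIntegral_intermediateField K x
  have hxE := isIntegral_intermediateField E x
  refine le_antisymm ?_ ?_
  · have hlift : minpoly K x ∈ lifts f := by
      rw [lifts_iff_coeff_lifts]
      exact fun i ↦ ⟨⟨(minpoly K x).coeff i, ((minpoly K x).coeff i).2,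
        coeff_minpoly_mem_adjoin K x i⟩, rfl⟩
    obtain ⟨q, hq, hdeg, hmon⟩ := lifts_and_natDegree_eq_and_monic hlift (minpoly.monic hxK)
    rw [← hdeg]
    refine natDegree_le_of_dvd (minpoly.dvd E x ?_) hmon.ne_zero
    rw [aeval_def, ← hf, ← eval₂_map, hq, ← aeval_def, minpoly.aeval]
  · rw [← natDegree_map_eq_of_injective f.injective (minpoly E x)]
    refine natDegree_le_of_dvd (minpoly.dvd K x ?_) ((minpoly.monic hxE).map f).ne_zero
    rw [aeval_def, eval₂_map, hf, ← aeval_def, minpoly.aeval]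

theorem finrank_adjoin_mul_natDegree {E : IntermediateField ℚ L} {x : L} (hE : E ≤ ℚ⟮x⟯) :
    finrank ℚ E * (minpoly E x).natDegree = finrank ℚ ℚ⟮x⟯ := by
  rw [← IntermediateField.adjoin.finrank (isIntegral_intermediateField E x), finrank_mul_finrank]
  have h : (E⟮x⟯).restrictScalars ℚ = ℚ⟮x⟯ := by
    apply le_antisymm
    · intro y hy
      have : E⟮x⟯ ≤ IntermediateField.extendScalars hE := by
        rw [IntermediateField.adjoin_simple_le_iff]
        exact IntermediateField.mem_adjoin_simple_self ℚ x
      exact this hy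
    · rw [IntermediateField.adjoin_simple_le_iff]
      exact IntermediateField.mem_adjoin_simple_self E x
  exact congrArg (fun M : IntermediateField ℚ L ↦ finrank ℚ M) h

theorem finrank_inf_mul_natDegree [Normal ℚ K] (x : L) :
    finrank ℚ ↥(K ⊓ ℚ⟮x⟯) * (minpoly K x).natDegree = finrank ℚ ℚ⟮x⟯ := by
  rw [← natDegree_minpoly_inf, finrank_adjoin_mul_natDegree inf_le_right]

theorem finrank_adjoin_le (E : IntermediateField ℚ L) [FiniteDimensional ℚ E] (y : L) :
    finrank ℚ ℚ⟮y⟯ ≤ finrank ℚ E * (minpoly E y).natDegree := by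
  have hy := isIntegral_intermediateField E y
  have := IntermediateField.adjoin.finiteDimensional hy
  have : FiniteDimensional ℚ (E⟮y⟯.restrictScalars ℚ) := FiniteDimensional.trans ℚ E E⟮y⟯
  have hle : ℚ⟮y⟯ ≤ E⟮y⟯.restrictScalars ℚ := by
    rw [IntermediateField.adjoin_simple_le_iff]
    exact IntermediateField.mem_adjoin_simple_self E y
  refine (IntermediateField.finrank_le_of_le_right hle).trans_eq ?_
  rw [← IntermediateField.adjoin.finrank hy, finrank_mul_finrank]
  rfl

theorem natDegree_minpoly_pos (x : L) : 0 < (minpoly K x).natDegree :=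
  minpoly.natDegree_pos (isIntegral_intermediateField K x)

theorem card_aroots_minpoly (x : L) :
    Multiset.card ((minpoly K x).aroots L) = (minpoly K x).natDegree :=
  (splits_iff_card_roots.mp (IsAlgClosed.splits _)).trans (natDegree_map _)

theorem prod_aroots_minpoly_mem [Normal ℚ K] (x : L) : ((minpoly K x).aroots L).prod ∈ K ⊓ ℚ⟮x⟯ := by
  have hs := (IsAlgClosed.splits ((minpoly K x).map (algebraMap K L)))
  have h := hs.coeff_zero_eq_prod_roots_of_monic
    ((minpoly.monic (isIntegral_intermediateField K x)).map _)
  rw [coeff_map, natDegree_map] at h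
  have h' : ((minpoly K x).aroots L).prod =
      (-1) ^ (minpoly K x).natDegree * ((minpoly K x).coeff 0 : L) := by
    rw [show (((minpoly K x).coeff 0 : K) : L) = _ from h, ← mul_assoc, ← mul_pow]
    simp
  rw [h']
  exact mul_mem (pow_mem (neg_mem (one_mem _)) _)
    ⟨((minpoly K x).coeff 0).2, coeff_minpoly_mem_adjoin K x 0⟩

theorem prod_aroots_minpoly_ne_zero {x : L} (hx : x ≠ 0) :
    ((minpoly K x).aroots L).prod ≠ 0 := by
  rw [Ne, Multiset.prod_eq_zero_iff, mem_aroots]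
  rintro ⟨-, h⟩
  have h0 : (minpoly K x).coeff 0 = 0 := by simpa [aeval_def, eval₂_at_zero] using h
  exact hx ((minpoly.coeff_zero_eq_zero (isIntegral_intermediateField K x)).mp h0)

theorem absMulHeight₁_prod_aroots_minpoly_le (x : L) :
    absMulHeight₁ ((minpoly K x).aroots L).prod ≤
      absMulHeight₁ x ^ (minpoly K x).natDegree := by
  have : Normal ℚ L := IsAlgClosure.normal ℚ L
  refine (absMulHeight₁_multiset_prod_le _).trans_eq ?_
  rw [← card_aroots_minpoly, ← Multiset.prod_replicate, ← Multiset.map_const']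
  congr 1
  refine Multiset.map_congr rfl fun y hy ↦ ?_
  have hxQ : IsIntegral ℚ x := Algebra.IsIntegral.isIntegral x
  have hy0 : aeval y (minpoly ℚ x) = 0 := by
    obtain ⟨q, hq⟩ := minpoly.dvd_map_of_isScalarTower ℚ K x
    have := congrArg (aeval y) hq
    rwa [aeval_map_algebraMap, map_mul, (mem_aroots.mp hy).2, zero_mul] at this
  obtain ⟨σ, rfl⟩ := minpoly.exists_algEquiv_of_root' hxQ.isAlgebraic hy0
  exact absMulHeight₁_algEquiv σ x

theorem exists_mem_rad_pow_eq [Normal ℚ K] {x : L} (hx : x ≠ 0) :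
    ∃ y ∈ rad K, y ^ (minpoly K x).natDegree = ((minpoly K x).aroots L).prod ∧
      mahlerMeasure y ≤ mahlerMeasure x := by
  set d := (minpoly K x).natDegree
  have hd : 0 < d := natDegree_minpoly_pos K x
  obtain ⟨y, hy⟩ := IsAlgClosed.exists_pow_nat_eq ((minpoly K x).aroots L).prod hd
  have hmem := prod_aroots_minpoly_mem K x
  have hy0 : y ≠ 0 := by
    rintro rfl
    exact prod_aroots_minpoly_ne_zero K hx (by rw [← hy, zero_pow hd.ne'])
  refine ⟨y, ⟨hy0, d, hd, hy ▸ hmem.1⟩, hy, ?_⟩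
  have hheight : absMulHeight₁ y ≤ absMulHeight₁ x := by
    rw [← pow_le_pow_iff_left₀ (absMulHeight₁_nonneg _) (absMulHeight₁_nonneg _) hd.ne',
      ← absMulHeight₁_pow, hy]
    exact absMulHeight₁_prod_aroots_minpoly_le K x
  set E := K ⊓ ℚ⟮x⟯
  have hxQ : IsIntegral ℚ x := Algebra.IsIntegral.isIntegral x
  have := numberField_adjoin hxQ
  have : FiniteDimensional ℚ E := finiteDimensional_of_le inf_le_right
  have hyE := isIntegral_intermediateField E y
  have hdeg : finrank ℚ ℚ⟮y⟯ ≤ finrank ℚ ℚ⟮x⟯ := calc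
    finrank ℚ ℚ⟮y⟯ ≤ finrank ℚ E * (minpoly E y).natDegree := finrank_adjoin_le E y
    _ ≤ finrank ℚ E * d := by
      refine Nat.mul_le_mul_left _ ?_
      -- `y` is a root of X ^ d - c over `E`, so its degree there is at most `d`.
      let c : E := ⟨_, hmem⟩
      rw [← natDegree_X_pow_sub_C (n := d) (r := c)]
      refine natDegree_le_of_dvd (minpoly.dvd E y ?_) (X_pow_sub_C_ne_zero hd c)
      rw [map_sub, map_pow, aeval_X, aeval_C, hy]
      exact sub_self _
    _ = finrank ℚ ℚ⟮x⟯ := finrank_inf_mul_natDegree K x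
  exact (pow_le_pow_left₀ (absMulHeight₁_nonneg _) hheight _).trans
    (pow_le_pow_right₀ (one_le_absMulHeight₁ x) hdeg)

/-- If x ^ r ∈ K, every conjugate of `x` over `K` has the same `r`-th power, so the product of the d
conjugates has `r`-th power x ^ (r d). -/
theorem absMulHeight₁_prod_aroots_minpoly_of_mem_rad {x : L} (hx : x ∈ rad K) :
    absMulHeight₁ ((minpoly K x).aroots L).prod =
      absMulHeight₁ x ^ (minpoly K x).natDegree := by
  obtain ⟨-, r, hr, hxr⟩ := hx
  have hprod : ((minpoly K x).aroots L).prod ^ r = (x ^ r) ^ (minpoly K x).natDegree := by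
    rw [← Multiset.map_id ((minpoly K x).aroots L), ← Multiset.prod_map_pow, ← card_aroots_minpoly, ← Multiset.prod_replicate,
      ← Multiset.map_const']
    congr 1
    refine Multiset.map_congr rfl fun y hy ↦ ?_
    obtain ⟨q, hq⟩ := minpoly.dvd K x (p := X ^ r - C ⟨_, hxr⟩) (by simp)
    have := congrArg (aeval y) hq
    rw [map_mul, (mem_aroots.mp hy).2, zero_mul, map_sub, map_pow, aeval_X, aeval_C] at this
    exact sub_eq_zero.mp this
  rw [← pow_left_inj₀ (absMulHeight₁_nonneg _) (pow_nonneg (absMulHeight₁_nonneg _) _) hr.ne',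
    ← absMulHeight₁_pow, hprod, absMulHeight₁_pow, absMulHeight₁_pow, pow_right_comm]

/-- M(x) = H(P) ^ [K ∩ ℚ(x) : ℚ] with P ∈ K: finitely many P by Northcott, and the exponent is at
most [K : ℚ]. -/
theorem finite_mahlerMeasure_rad_le [Normal ℚ K] [FiniteDimensional ℚ K] (B : ℝ) :
    {m : ℝ | m ≤ B ∧ ∃ x ∈ rad K, mahlerMeasure x = m}.Finite := by
  refine (((finite_setOf_absMulHeight₁_le K B).prod (Set.finite_Iic (finrank ℚ K))).image
    fun p : L × ℕ ↦ absMulHeight₁ p.1 ^ p.2).subset ?_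
  rintro m ⟨hB, x, hx, rfl⟩
  have hM : absMulHeight₁ ((minpoly K x).aroots L).prod ^ finrank ℚ ↥(K ⊓ ℚ⟮x⟯) =
      mahlerMeasure x := by
    rw [absMulHeight₁_prod_aroots_minpoly_of_mem_rad K hx, mahlerMeasure, ← pow_mul, mul_comm,
      finrank_inf_mul_natDegree]
  have : FiniteDimensional ℚ ↥(K ⊓ ℚ⟮x⟯) := finiteDimensional_of_le inf_le_left
  refine ⟨(((minpoly K x).aroots L).prod, finrank ℚ ↥(K ⊓ ℚ⟮x⟯)), ⟨⟨?_, ?_⟩, ?_⟩, hM⟩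
  · exact (prod_aroots_minpoly_mem K x).1
  · refine le_trans ?_ (hM.le.trans hB)
    exact le_self_pow₀ (one_le_absMulHeight₁ _) finrank_pos.ne'
  · exact IntermediateField.finrank_le_of_le_right inf_le_left

/-- Take norms from F = K(a₁, a₂, …) to `K`: the product, lying in `K`, is raised to the power [F :
K], while each aᵢ has norm Pᵢ ^ [F : K(aᵢ)] = bᵢ ^ [F : K]. -/
theorem exists_pow_prod_eq {ι : Type*} [Fintype ι] (a b : ι → L) (ha : ∏ i, a i ∈ K)
    (hb : ∀ i, b i ^ (minpoly K (a i)).natDegree = ((minpoly K (a i)).aroots L).prod) :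
    ∃ n : ℕ, n ≠ 0 ∧ (∏ i, a i) ^ n = (∏ i, b i) ^ n := by
  let F := IntermediateField.adjoin K (Set.range a)
  have : FiniteDimensional K F :=
    IntermediateField.finiteDimensional_adjoin fun x _ ↦ isIntegral_intermediateField K x
  let a' (i : ι) : F := ⟨a i, IntermediateField.subset_adjoin _ _ ⟨i, rfl⟩⟩
  let c : K := ⟨_, ha⟩
  have hc : ∏ i, a' i = algebraMap K F c := by
    apply (algebraMap F L).injective
    rw [map_prod]
    rfl
  refine ⟨finrank K F, finrank_pos.ne', ?_⟩
  calc (∏ i, a i) ^ finrank K F = algebraMap K L (Algebra.norm K (algebraMap K F c)) := by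
        rw [Algebra.norm_algebraMap, map_pow]; rfl
    _ = ∏ i, algebraMap K L (Algebra.norm K (a' i)) := by rw [← hc, map_prod, map_prod]
    _ = ∏ i, b i ^ finrank K F := by
        refine Finset.prod_congr rfl fun i _ ↦ ?_
        have hmin : minpoly K (a' i) = minpoly K (a i) :=
          (minpoly.algebraMap_eq (algebraMap F L).injective (a' i)).symm
        have : Module.Free K K⟮a' i⟯ := Module.Free.of_divisionRing _ _
        have : Module.Free K⟮a' i⟯ F := Module.Free.of_divisionRing _ _
        have hdeg := finrank_mul_finrank K K⟮a' i⟯ F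
        rw [Algebra.norm_eq_prod_roots L (IsAlgClosed.splits _), hmin, ← hb, ← pow_mul, ← hmin,
          ← IntermediateField.adjoin.finrank (Algebra.IsIntegral.isIntegral (a' i)),
          hdeg]
    _ = (∏ i, b i) ^ finrank K F := Finset.prod_pow _ _ _

theorem exists_rad_representation [Normal ℚ K] {N : ℕ} (a : Fin (N + 1) → L) (ha0 : ∀ n, a n ≠ 0)
    (ha : ∏ n, a n ∈ K) :
    ∃ (N' : ℕ) (b : Fin (N' + 1) → L), (∀ n, b n ∈ rad K) ∧ ∏ n, b n = ∏ n, a n ∧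
      maxMahler b ≤ maxMahler a := by
  choose b hbrad hb hbM using fun n ↦ exists_mem_rad_pow_eq K (ha0 n)
  obtain ⟨m, hm, hpow⟩ := exists_pow_prod_eq K a b ha hb
  have hb0 : ∏ n, b n ≠ 0 := Finset.prod_ne_zero_iff.mpr fun n _ ↦ (hbrad n).1
  let z := (∏ n, a n) / ∏ n, b n
  have hz : z ^ m = 1 := by rw [div_pow, hpow, div_self (pow_ne_zero _ hb0)]
  -- The root of unity `z` becomes an extra factor; its measure 1 cannot raise the maximum.
  refine ⟨N + 1, Fin.cons z b, ?_, ?_, ?_⟩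
  · refine Fin.cases ⟨?_, m, hm.bot_lt, ?_⟩ hbrad
    · exact div_ne_zero (Finset.prod_ne_zero_iff.mpr fun n _ ↦ ha0 n) hb0
    · rw [Fin.cons_zero, hz]
      exact one_mem K
  · rw [Fin.prod_cons, div_mul_cancel₀ _ hb0]
  · refine Finset.sup'_le _ _ fun n _ ↦ ?_
    have hle (n : Fin (N + 1)) : mahlerMeasure (a n) ≤ maxMahler a :=
      Finset.le_sup' (fun n ↦ mahlerMeasure (a n)) (Finset.mem_univ n)
    refine Fin.cases ?_ (fun n ↦ ?_) n
    · rw [Fin.cons_zero, mahlerMeasure_eq_one_of_pow_eq_one hm hz]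
      exact (one_le_mahlerMeasure (a 0)).trans (hle 0)
    · rw [Fin.cons_succ]
      exact (hbM n).trans (hle n)

end Normal

/-- The infimum defining the ultrametric Mahler measure of `α` is attained by a factorization of
`α` in `rad K_α`. -/
theorem exists_rad_galoisClosure_ultrametricMahler_eq [IsAlgClosure ℚ L] {α : L} (hα : α ≠ 0) :
    ∃ (N : ℕ) (a : Fin (N + 1) → L), (∀ n, a n ∈ rad (galoisClosure α)) ∧ α = ∏ n, a n ∧
      ultrametricMahler α = maxMahler a := by
  have : Normal ℚ L := IsAlgClosure.normal ℚ L
  have := numberField_adjoin (Algebra.IsIntegral.isIntegral (R := ℚ) α)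
  let K := galoisClosure α
  have : Normal ℚ K := normalClosure.normal ℚ ℚ⟮α⟯ L
  have : FiniteDimensional ℚ K := normalClosure.is_finiteDimensional ℚ ℚ⟮α⟯ L
  have hαK : α ∈ K := ℚ⟮α⟯.le_normalClosure (IntermediateField.mem_adjoin_simple_self ℚ α)
  have hrad : α ∈ rad K := ⟨hα, 1, one_pos, by rwa [pow_one]⟩
  let S : Set ℝ := {m | ∃ (N : ℕ) (a : Fin (N + 1) → L),
    (∀ n, a n ∈ rad K) ∧ α = ∏ n, a n ∧ m = maxMahler a}
  let a₀ : Fin (0 + 1) → L := fun _ ↦ α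
  have hS₀ : maxMahler a₀ ∈ S := ⟨0, a₀, fun _ ↦ hrad, by simp [a₀], rfl⟩
  have hfin : (S ∩ Set.Iic (maxMahler a₀)).Finite := by
    refine (finite_mahlerMeasure_rad_le K (maxMahler a₀)).subset ?_
    rintro m ⟨⟨N, a, ha, -, rfl⟩, hm⟩
    obtain ⟨n, -, hn⟩ := Finset.exists_mem_eq_sup' (Finset.univ_nonempty (α := Fin (N + 1)))
      fun n ↦ mahlerMeasure (a n)
    exact ⟨hm, a n, ha n, hn.symm⟩
  obtain ⟨m, ⟨⟨N, a, ha, hprod, rfl⟩, hm⟩, hmin⟩ :=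
    Set.exists_min_image _ id hfin ⟨_, hS₀, Set.mem_Iic.mpr le_rfl⟩
  refine ⟨N, a, ha, hprod, IsLeast.csInf_eq ⟨⟨N, a, fun n ↦ (ha n).1, hprod, rfl⟩, ?_⟩⟩
  rintro _ ⟨N', b, hb0, hb, rfl⟩
  obtain ⟨N'', c, hc, hcb, hle⟩ := exists_rad_representation K b hb0 (hb ▸ hαK)
  refine le_trans ?_ hle
  -- The minimum was taken only over values up to that of the trivial factorization `a₀`; larger
  -- values exceed it anyway.
  by_cases hcm : maxMahler c ≤ maxMahler a₀
  · exact hmin _ ⟨⟨N'', c, hc, hb.trans hcb.symm, rfl⟩, hcm⟩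
  · exact le_trans hm (not_le.mp hcm).le

end AlgNumber

theorem theorem1p2 {L : Type*} [Field L] [CharZero L] [IsAlgClosure ℚ L] (α : L) (hα : α ≠ 0) :
    ∃ (N : ℕ) (a : Fin (N + 1) → L),
      (∀ n, a n ∈ AlgNumber.rad (AlgNumber.galoisClosure α)) ∧
      α = ∏ n, a n ∧
      AlgNumber.ultrametricMahler α = AlgNumber.maxMahler a :=
  AlgNumber.exists_rad_galoisClosure_ultrametricMahler_eq hα
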